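/- \textbf{Memoryless determinacy of first cycle games.} Let $\mathcal A=(V_0,V_1,E,\mathbb U,\lambda)$ be a finite arena: $V=V_0\sqcup V_1$ is a finite non-empty set of vertices, partitioned into those of Player $0$ and those of Player $1$; $E\subseteq V\times V$ is such that every vertex has an outgoing edge; and $\lambda:E\to\mathbb U$ labels edges by elements of a set $\mathbb U$. A \emph{play} is an infinite sequence $\pi=\pi_0\pi_1\cdots$ over $V$ with $(\pi_j,\pi_{j+1})\in E$ for all $j$. A \emph{strategy} for Player $i$ is a function $S:V^*V_i\to V$ with $(v,S(uv))\in E$ for all $u\in V^*$, $v\in V_i$; it is \emph{memoryless} if $S(uv)$ depends only on $v$. A play $\pi$ is \emph{consistent} with $S$ if $\pi_{j+1}=S(\pi_0\cdots\pi_j)$ whenever $\pi_j\in V_i$. In the game $(\mathcal A,O)$ with objective $O$, a set of plays, a play is won by Player $0$ if it is in $O$ and by Player $1$ otherwise; $S$ is \emph{winning from} $v$ if every play starting at $v$ and consistent with $S$ is won by Player $i$. The \emph{winning region} of Player $i$ is the set of vertices from which Player $i$ has a winning strategy. The game is \emph{determined} if the two winning regions partition $V$. It is \emph{pointwise memoryless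 determined} if it is determined and, for each player, from every vertex of that player's winning region that player has a memoryless winning strategy. It is \emph{uniform memoryless determined} if it is determined and each player has a single memoryless strategy that is winning from every vertex of that player's winning region. The \emph{cycles-decomposition} of a play $\pi$ is the sequence of cycles output by the following algorithm: start with an empty stack; at step $j=0,1,2,\dots$ push the edge $(\pi_j,\pi_{j+1})$, and if for some $k\ge1$ the top $k$ edges of the stack form a cycle $(v_1,v_2)(v_2,v_3)\cdots(v_k,v_1)$, pop this cycle and output it. For a finite sequence $u=e_1\cdots e_k$ of edges write $\lambda(u)=\lambda(e_1)\cdots\lambda(e_k)$. Let $Y\subseteq\mathbb U^*$ be a cycle property and $\neg Y=\mathbb U^*\setminus Y$. The \emph{first cycle game} of $Y$ on $\mathcal A$ has as objective the set of plays $\pi$ such that $\lambda(u)\in Y$, where $u$ is the first cycle in the cycles-decomposition of $\pi$. The \emph{suffix all-cycles objective} of $Y$ on $\mathcal A$ is the set of plays $\pi$ that have a suffix $\pi'$ such that $\lambda(u)\in Y$ for every cycle $u$ in the cycles-decomposition of $\pi'$. The arena $\mathcal A$ is \emph{$Y$-unambiguous} if no play lies both in the suffix all-cycles objective of $Y$ and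 in that of $\neg Y$. The property $Y$ is \emph{closed under cyclic permutations} if $ab\in Y$ implies $ba\in Y$ for all $a\in\mathbb U$, $b\in\mathbb U^*$. \textbf{Theorem.} If $\mathcal A$ is $Y$-unambiguous, then the first cycle game of $Y$ on $\mathcal A$ is pointwise memoryless determined. If $Y$ is also closed under cyclic permutations, then this game is uniform memoryless determined. -/

import Mathlib

namespace CycleGame

/-- An arena with vertex set `V` and label set `U`. The sets of vertices of Player 0 and Player 1
are the fibres of `owner`. The labelling of the edge set is given as a function on all pairs of
vertices (the edge set is nonempty when `V` is, so any labelling of edges extends); its values on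
pairs that are not edges are never used, since labels are only read along plays. -/
structure Arena (V U : Type*) where
  owner : V → Fin 2
  edge : V → V → Prop
  noDeadEnd : ∀ v, ∃ w, edge v w
  label : V × V → U

/-! ### Cycles-decomposition -/

section Decomposition

variable {V : Type*}

/-- A sequence of edges `(v₁,v₂)(v₂,v₃)⋯(vₖ,v₁)` with `k ≥ 1`, listed in the order of traversal. -/
def IsCycle (c : List (V × V)) : Prop :=
  ∃ h : c ≠ [], c.IsChain (fun e f => e.2 = f.1) ∧ (c.getLast h).2 = (c.head h).1

/-- The top `k` edges of a stack. A stack is listed from its bottom to its top. -/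
def topEdges (s : List (V × V)) (k : ℕ) : List (V × V) := s.drop (s.length - k)

/-- What is left of a stack after popping its top `k` edges. -/
def popEdges (s : List (V × V)) (k : ℕ) : List (V × V) := s.take (s.length - k)

open Classical in
/-- One step after a push: if for some `k` the top `k` edges form a cycle, pop and output it.
Returns the new stack and the output of the step. -/
noncomputable def popCycle (s : List (V × V)) : List (V × V) × Option (List (V × V)) :=
  if h : ∃ k, IsCycle (topEdges s k) then
    (popEdges s (Nat.find h), some (topEdges s (Nat.find h)))
  else (s, none)

/-- The stack at the beginning of step `j` of the algorithm run on `π`. -/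
noncomputable def stack (π : ℕ → V) : ℕ → List (V × V)
  | 0 => []
  | j + 1 => (popCycle (stack π j ++ [(π j, π (j + 1))])).1

/-- The cycle output at step `j` of the algorithm run on `π`, if there is one. -/
noncomputable def output (π : ℕ → V) (j : ℕ) : Option (List (V × V)) :=
  (popCycle (stack π j ++ [(π j, π (j + 1))])).2

/-- `u` occurs in the cycles-decomposition of `π`. -/
def MemCycles (π : ℕ → V) (u : List (V × V)) : Prop := ∃ j, output π j = some u

/-- `u` is the first cycle in the cycles-decomposition of `π`. -/
def IsFirstCycle (π : ℕ → V) (u : List (V × V)) : Prop :=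
  ∃ j, output π j = some u ∧ ∀ i < j, output π i = none

end Decomposition

section Games

variable {V U : Type*}

/-- The plays of an arena. -/
def plays (A : Arena V U) : Set (ℕ → V) := {π | ∀ j, A.edge (π j) (π (j + 1))}

/-- A strategy for Player `i`: `move u v` is the choice made after the history `u` followed by the
current vertex `v`. Only its values at vertices `v` of Player `i` matter. -/
structure Strategy (A : Arena V U) (i : Fin 2) where
  move : List V → V → V
  legal : ∀ u v, A.owner v = i → A.edge v (move u v)

def Strategy.Memoryless {A : Arena V U} {i : Fin 2} (S : Strategy A i) : Prop :=
  ∀ u u' v, A.owner v = i → S.move u v = S.move u' v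

/-- The play `π` is consistent with `S`. -/
def Strategy.Consistent {A : Arena V U} {i : Fin 2} (S : Strategy A i) (π : ℕ → V) : Prop :=
  ∀ j, A.owner (π j) = i → π (j + 1) = S.move ((List.range j).map π) (π j)

/-- With objective `O`, a play is won by Player 0 if it lies in `O`, and by Player 1 otherwise. -/
def WonBy (O : Set (ℕ → V)) (i : Fin 2) (π : ℕ → V) : Prop :=
  if i = 0 then π ∈ O else π ∉ O

/-- `S` is winning starting from `v` in the game `(A, O)`. -/
def Strategy.WinningFrom {A : Arena V U} {i : Fin 2} (S : Strategy A i) (O : Set (ℕ → V))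
    (v : V) : Prop :=
  ∀ π ∈ plays A, π 0 = v → S.Consistent π → WonBy O i π

def winningRegion (A : Arena V U) (O : Set (ℕ → V)) (i : Fin 2) : Set V :=
  {v | ∃ S : Strategy A i, S.WinningFrom O v}

def memorylessWinningRegion (A : Arena V U) (O : Set (ℕ → V)) (i : Fin 2) : Set V :=
  {v | ∃ S : Strategy A i, S.Memoryless ∧ S.WinningFrom O v}

/-- The winning regions of the two players partition the set of vertices. -/
def Determined (A : Arena V U) (O : Set (ℕ → V)) : Prop :=
  Disjoint (winningRegion A O 0) (winningRegion A O 1) ∧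
    winningRegion A O 0 ∪ winningRegion A O 1 = Set.univ

def PointwiseMemoryless (A : Arena V U) (O : Set (ℕ → V)) (i : Fin 2) : Prop :=
  memorylessWinningRegion A O i = winningRegion A O i

def UniformMemoryless (A : Arena V U) (O : Set (ℕ → V)) (i : Fin 2) : Prop :=
  ∃ S : Strategy A i, S.Memoryless ∧ ∀ v ∈ winningRegion A O i, S.WinningFrom O v

def PointwiseMemorylessDetermined (A : Arena V U) (O : Set (ℕ → V)) : Prop :=
  Determined A O ∧ ∀ i, PointwiseMemoryless A O i

def UniformMemorylessDetermined (A : Arena V U) (O : Set (ℕ → V)) : Prop :=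
  Determined A O ∧ ∀ i, UniformMemoryless A O i

/-- The objective of the first cycle game of `Y` on `A`. -/
def firstCycleObjective (A : Arena V U) (Y : Set (List U)) : Set (ℕ → V) :=
  {π | π ∈ plays A ∧ ∃ u, IsFirstCycle π u ∧ u.map A.label ∈ Y}

/-- The suffix all-cycles objective of `Y` on `A`. -/
def suffixAllCyclesObjective (A : Arena V U) (Y : Set (List U)) : Set (ℕ → V) :=
  {π | π ∈ plays A ∧ ∃ m, ∀ u, MemCycles (fun n => π (m + n)) u → u.map A.label ∈ Y}

/-- The arena `A` is `Y`-unambiguous. -/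
def Unambiguous (A : Arena V U) (Y : Set (List U)) : Prop :=
  suffixAllCyclesObjective A Y ∩ suffixAllCyclesObjective A Yᶜ = ∅

def ClosedUnderCyclicPermutations (Y : Set (List U)) : Prop :=
  ∀ (a : U) (b : List U), a :: b ∈ Y → b ++ [a] ∈ Y

end Games

end CycleGame

namespace CycleGame

/-! ### Popping a cycle from the stack -/

section PopCycle

variable {V : Type*}

/-! A player who wins the first cycle game from `a` can go on for ever: popping a cycle leaves an
earlier prefix of the same winning path, ending at the current vertex, so every cycle output is good
(`Trace.force`). Such a player may also forget the stack once, at a vertex from which that player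
wins. If opposing players won two such variants from the same vertex, playing them against each
other would give a play in both suffix all-cycles objectives (`exists_ambiguous_play`). Hence on an
unambiguous arena the winner does not change if the game is stopped on entering a vertex `z` and
awarded to whoever wins from `z` (`win_iff_win_reset`).

So one edge at `z` suffices for its owner: from `z`, a return closes a cycle and ends the game; from
elsewhere, the stopped game never moves out of `z`. `exists_restrict_vertex` thus deletes the other
edges at `z` while keeping every win of the owner. Doing so at all vertices of one player in turn
(`exists_restrict_set`) leaves a single memoryless strategy for the whole region; the pointwise
statement follows. -/

theorem popCycle_of_none {s : List (V × V)} (h : (popCycle s).2 = none) :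
    (popCycle s).1 = s ∧ ∀ s₁ c, s = s₁ ++ c → ¬ IsCycle c := by
  unfold popCycle at *
  split_ifs at * with hk
  · refine ⟨rfl, fun s₁ c hs hc => hk ⟨c.length, ?_⟩⟩
    subst hs
    simpa [topEdges] using hc

theorem popCycle_of_some {s c : List (V × V)} (h : (popCycle s).2 = some c) :
    s = (popCycle s).1 ++ c ∧ IsCycle c := by
  classical
  unfold popCycle at *
  split_ifs at * with hk
  · simp only [Option.some.injEq] at h
    subst h
    exact ⟨(List.take_append_drop _ _).symm, Nat.find_spec hk⟩

end PopCycle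

/-! ### One-move control -/

section Force

variable {V : Type*} {E : V → V → Prop} {own : V → Prop} {v : V} {R R' : V → Prop}

/-- The player who owns the vertices satisfying `own` can ensure that the successor of `v`
satisfies `R`. -/
def Force (E : V → V → Prop) (own : V → Prop) (v : V) (R : V → Prop) : Prop :=
  (own v → ∃ w, E v w ∧ R w) ∧ (¬ own v → ∀ w, E v w → R w)

theorem Force.mono (h : Force E own v R) (hR : ∀ w, E v w → R w → R' w) :
    Force E own v R' :=
  ⟨fun hv => (h.1 hv).imp fun w hw => ⟨hw.1, hR w hw.1 hw.2⟩,
    fun hv w hw => hR w hw (h.2 hv w hw)⟩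

theorem force_compl_of_not_force (h : ¬ Force E own v R) :
    Force E (fun v => ¬ own v) v (fun w => ¬ R w) := by
  unfold Force at *
  by_cases hv : own v <;> simp_all

theorem Force.exists_common (h : Force E own v R)
    (h' : Force E (fun v => ¬ own v) v R') : ∃ w, E v w ∧ R w ∧ R' w := by
  by_cases hv : own v
  · obtain ⟨w, hw, hR⟩ := h.1 hv
    exact ⟨w, hw, hR, h'.2 (not_not.2 hv) w hw⟩
  · obtain ⟨w, hw, hR⟩ := h'.1 hv
    exact ⟨w, hw, h.2 hv w hw, hR⟩

end Force

/-! ### Winning positions of the stopped first cycle game -/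

section Win

variable {V : Type*}

/-- The condition on moving from `v` to `w` with stack `st`: if `w` lies in the stop set `Z` then
the game ends with value `τ`; otherwise a cycle that is closed has to lie in `C`, and if none is
closed then `P` has to hold of the new position. -/
def Cont (C : Set (List (V × V))) (Z : Set V) (τ : Prop) (P : V → List (V × V) → Prop)
    (st : List (V × V)) (v w : V) : Prop :=
  (w ∈ Z → τ) ∧ (w ∉ Z → (∀ c, (popCycle (st ++ [(v, w)])).2 = some c → c ∈ C) ∧
    ((popCycle (st ++ [(v, w)])).2 = none → P w (st ++ [(v, w)])))

theorem Cont.mono {C : Set (List (V × V))} {Z : Set V} {τ τ' : Prop}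
    {P P' : V → List (V × V) → Prop} {st : List (V × V)} {v w : V}
    (h : Cont C Z τ P st v w) (hτ : w ∈ Z → τ → τ')
    (hP : w ∉ Z → P w (st ++ [(v, w)]) → P' w (st ++ [(v, w)])) : Cont C Z τ' P' st v w :=
  ⟨fun hw => hτ hw (h.1 hw), fun hw => ⟨(h.2 hw).1, fun hn => hP hw ((h.2 hw).2 hn)⟩⟩

theorem cont_compl_of_not_cont {C : Set (List (V × V))} {Z : Set V} {τ : Prop}
    {P : V → List (V × V) → Prop} {st : List (V × V)} {v w : V} (h : ¬ Cont C Z τ P st v w) :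
    Cont Cᶜ Z (¬ τ) (fun v st => ¬ P v st) st v w := by
  unfold Cont at *
  by_cases hw : w ∈ Z
  · simp_all
  · cases ho : (popCycle (st ++ [(v, w)])).2 <;> simp_all

/-- The player who owns the vertices satisfying `own` wins the first cycle game with winning
cycles `C` that stops with value `τ` on entering `Z`, from vertex `v` with stack `st`. -/
def Win (E : V → V → Prop) (own : V → Prop) (C : Set (List (V × V))) (Z : Set V) (τ : Prop)
    (v : V) (st : List (V × V)) : Prop :=
  ∃ P : V → List (V × V) → Prop,
    (∀ v st, P v st → Force E own v (Cont C Z τ P st v)) ∧ P v st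

variable {E : V → V → Prop} {own : V → Prop} {C : Set (List (V × V))} {Z : Set V} {τ τ' : Prop}
  {v : V} {st : List (V × V)}

/-- `Win` is a greatest fixed point, so an infinite play that closes no cycle counts as won. This is
harmless: on finitely many vertices a cycle always closes. -/
theorem Win.force (h : Win E own C Z τ v st) :
    Force E own v (Cont C Z τ (Win E own C Z τ) st v) := by
  obtain ⟨P, hP, hv⟩ := h
  exact (hP v st hv).mono fun w _ hw => hw.mono (fun _ => id) fun _ h => ⟨P, hP, h⟩

theorem win_of_force (h : Force E own v (Cont C Z τ (Win E own C Z τ) st v)) :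
    Win E own C Z τ v st :=
  ⟨fun v st => Force E own v (Cont C Z τ (Win E own C Z τ) st v), fun _ _ h =>
    h.mono fun _ _ hw => hw.mono (fun _ => id) fun _ h => h.force, h⟩

theorem Win.mono (h : Win E own C Z τ v st) (hτ : Z.Nonempty → τ → τ') :
    Win E own C Z τ' v st :=
  ⟨Win E own C Z τ, fun _ _ h => h.force.mono fun w _ hw =>
    hw.mono (fun hw => hτ ⟨w, hw⟩) fun _ => id, h⟩

/-- The positions that are not won form an invariant for the opponent. This is the source of
determinacy. -/
theorem win_compl_of_not_win (h : ¬ Win E own C Z τ v st) :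
    Win E (fun v => ¬ own v) Cᶜ Z (¬ τ) v st :=
  ⟨fun v st => ¬ Win E own C Z τ v st, fun _ _ h =>
    (force_compl_of_not_force fun hf => h (win_of_force hf)).mono fun _ _ hw =>
      cont_compl_of_not_cont hw, h⟩

end Win

/-! ### Playing on after a cycle is popped -/

section Trace

variable {V : Type*}

/-- `st` is the edge sequence of a path from `a` to `v`, all of whose prefixes satisfy `P`. -/
inductive Trace (P : V → List (V × V) → Prop) (a : V) : List (V × V) → V → Prop
  | nil : P a [] → Trace P a [] a
  | snoc {st : List (V × V)} {v w : V} :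
      Trace P a st v → P w (st ++ [(v, w)]) → Trace P a (st ++ [(v, w)]) w

variable {P : V → List (V × V) → Prop} {a v w : V} {st : List (V × V)}

theorem Trace.holds (h : Trace P a st v) : P v st := by
  cases h <;> assumption

theorem Trace.of_snoc {e : V × V} (h : Trace P a (st ++ [e]) v) : Trace P a st e.1 := by
  generalize hs : st ++ [e] = s at h
  cases h with
  | nil => simp at hs
  | snoc h _ =>
    obtain ⟨rfl, he⟩ := List.append_inj' hs rfl
    simp only [List.cons.injEq, and_true] at he
    subst he
    exact h

theorem Trace.of_append {c : List (V × V)} (hc : c ≠ []) (h : Trace P a (st ++ c) v) :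
    Trace P a st (c.head hc).1 := by
  induction c using List.reverseRecOn generalizing v with
  | nil => exact absurd rfl hc
  | append_singleton c e ih =>
    rw [← List.append_assoc] at h
    by_cases hc' : c = []
    · subst hc'
      simpa using h.of_snoc
    · rw [List.head_append_of_ne_nil hc']
      exact ih hc' h.of_snoc

theorem Trace.popCycle (h : Trace P a st v)
    (hP : (popCycle (st ++ [(v, w)])).2 = none → P w (st ++ [(v, w)])) :
    Trace P a (popCycle (st ++ [(v, w)])).1 w := by
  cases ho : (CycleGame.popCycle (st ++ [(v, w)])).2 with
  | none =>
    rw [(popCycle_of_none ho).1]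
    exact h.snoc (hP ho)
  | some c =>
    obtain ⟨hs, hc, -, hlast⟩ := popCycle_of_some ho
    obtain ⟨c', e, rfl⟩ := List.eq_nil_or_concat' c |>.resolve_left hc
    rw [← List.append_assoc] at hs
    obtain ⟨hst, he⟩ := List.append_inj' hs rfl
    simp only [List.cons.injEq, and_true] at he
    subst he
    simp only [List.getLast_append_singleton] at hlast
    clear hs ho hP
    generalize (CycleGame.popCycle (st ++ [(v, w)])).1 = s at hst ⊢
    -- The popped cycle starts where it ends, at `w`, so the remaining stack is a prefix of the path
    -- that ends at `w`.
    rw [hlast]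
    by_cases hc' : c' = []
    · subst hc'
      rw [List.append_nil] at hst
      subst hst
      simpa using h
    · simp only [List.head_append_of_ne_nil hc']
      exact Trace.of_append hc' (hst ▸ h)

variable {E : V → V → Prop} {own : V → Prop} {C : Set (List (V × V))} {Z : Set V} {τ : Prop}

theorem Trace.force (h : Trace (Win E own C Z τ) a st v) :
    Force E own v fun w => (w ∈ Z ∧ τ) ∨
      ((∀ c, (CycleGame.popCycle (st ++ [(v, w)])).2 = some c → c ∈ C) ∧
        Trace (Win E own C Z τ) a (CycleGame.popCycle (st ++ [(v, w)])).1 w) := by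
  refine h.holds.force.mono fun w _ hw => ?_
  by_cases hZ : w ∈ Z
  · exact Or.inl ⟨hZ, hw.1 hZ⟩
  · exact Or.inr ⟨(hw.2 hZ).1, h.popCycle (hw.2 hZ).2⟩

end Trace

/-! ### Resetting the stack, and ambiguous plays -/

section Ambiguity

variable {V : Type*}

/-- Some suffix of `π` has only cycles from `C` in its cycles-decomposition. -/
def EventuallyCycles (C : Set (List (V × V))) (π : ℕ → V) : Prop :=
  ∃ m, ∀ u, MemCycles (fun n => π (m + n)) u → u ∈ C

/-- A step of the decomposition algorithm that may forget its stack once. The flag tells whether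
this has happened. -/
def ResetStep (C : Set (List (V × V))) (v w : V) (s t : List (V × V) × Bool) : Prop :=
  (s.2 = false ∧ t = ([], true)) ∨
    (t = ((popCycle (s.1 ++ [(v, w)])).1, s.2) ∧
      ∀ c, (popCycle (s.1 ++ [(v, w)])).2 = some c → c ∈ C)

theorem eventuallyCycles_of_stack {C : Set (List (V × V))} {π : ℕ → V}
    {s : ℕ → List (V × V)} {m : ℕ} (h0 : s m = [])
    (hs : ∀ n, s (m + n + 1) = (popCycle (s (m + n) ++ [(π (m + n), π (m + n + 1))])).1)
    (hC : ∀ n c, (popCycle (s (m + n) ++ [(π (m + n), π (m + n + 1))])).2 = some c → c ∈ C) :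
    EventuallyCycles C π := by
  have key : ∀ n, stack (fun n => π (m + n)) n = s (m + n) := by
    intro n
    induction n with
    | zero => exact h0.symm
    | succ n ih => rw [stack, ih, ← add_assoc, hs]
  refine ⟨m, fun u ⟨n, hn⟩ => hC n u ?_⟩
  rwa [output, key] at hn

theorem eventuallyCycles_of_resetStep {C : Set (List (V × V))} {π : ℕ → V}
    {s : ℕ → List (V × V) × Bool} (h0 : s 0 = ([], false))
    (hs : ∀ n, ResetStep C (π n) (π (n + 1)) (s n) (s (n + 1))) : EventuallyCycles C π := by
  classical
  by_cases hm : ∃ m, (s m).2 = true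
  · obtain ⟨m, hm, hmin⟩ : ∃ m, (s m).2 = true ∧ ∀ k < m, (s k).2 ≠ true :=
      ⟨Nat.find hm, Nat.find_spec hm, fun k hk => Nat.find_min hm hk⟩
    have htrue : ∀ n, (s (m + n)).2 = true := by
      intro n
      induction n with
      | zero => exact hm
      | succ n ih =>
        rcases hs (m + n) with h | h
        · simp [h.1] at ih
        · rw [← add_assoc, h.1]
          exact ih
    have hstep : ∀ n, _ := fun n => (hs (m + n)).resolve_left (by simp [htrue n])
    refine eventuallyCycles_of_stack (s := fun n => (s n).1) (m := m) ?_
      (fun n => by simp [(hstep n).1]) fun n => (hstep n).2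
    -- The stack at `m` is empty: either nothing has been pushed, or minimality of `m` makes the
    -- preceding step the reset.
    obtain - | m := m
    · simp [h0]
    · rcases hs m with h | h
      · simp [h.2]
      · rw [h.1] at hm
        exact absurd hm (hmin m (Nat.lt_succ_self m))
  · have hstep : ∀ n, _ := fun n => (hs n).resolve_left fun h => hm ⟨n + 1, by simp [h.2]⟩
    exact eventuallyCycles_of_stack (s := fun n => (s n).1) (m := 0) (by simp [h0])
      (fun n => by simp [(hstep n).1]) fun n => by simpa using (hstep n).2

/-- The positions from which a player wins the game that forgets the history on entering `Z`. -/
def ResetInv (E : V → V → Prop) (own : V → Prop) (C : Set (List (V × V))) (Z : Set V) (τ : Prop)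
    (v : V) (s : List (V × V) × Bool) : Prop :=
  (s.2 = false ∧ ∃ a, Trace (Win E own C Z τ) a s.1 v) ∨
    (s.2 = true ∧ ∃ a, Trace (Win E own C ∅ True) a s.1 v)

variable {E : V → V → Prop} {own : V → Prop} {C D : Set (List (V × V))} {Z Z' : Set V}
  {τ τ' : Prop} {a v : V}

theorem ResetInv.force {s : List (V × V) × Bool} (hZ : ∀ z ∈ Z, τ → Win E own C ∅ True z [])
    (h : ResetInv E own C Z τ v s) :
    Force E own v fun w => ∃ t, ResetStep C v w s t ∧ ResetInv E own C Z τ w t := by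
  rcases h with ⟨hs, a, h⟩ | ⟨hs, a, h⟩
  · refine h.force.mono fun w _ hw => ?_
    rcases hw with ⟨hwZ, hτ⟩ | ⟨hC, ht⟩
    · exact ⟨([], true), Or.inl ⟨hs, rfl⟩, Or.inr ⟨rfl, w, .nil (hZ w hwZ hτ)⟩⟩
    · exact ⟨_, Or.inr ⟨rfl, hC⟩, Or.inl ⟨hs, a, ht⟩⟩
  · refine h.force.mono fun w _ hw => ?_
    rcases hw with ⟨hwZ, -⟩ | ⟨hC, ht⟩
    · exact absurd hwZ (Set.notMem_empty w)
    · exact ⟨_, Or.inr ⟨rfl, hC⟩, Or.inr ⟨hs, a, ht⟩⟩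

theorem exists_ambiguous_play (hZ : ∀ z ∈ Z, τ → Win E own C ∅ True z []) (h : Win E own C Z τ a [])
    (hZ' : ∀ z ∈ Z', τ' → Win E (fun v => ¬ own v) D ∅ True z [])
    (h' : Win E (fun v => ¬ own v) D Z' τ' a []) :
    ∃ π : ℕ → V, (∀ n, E (π n) (π (n + 1))) ∧ EventuallyCycles C π ∧ EventuallyCycles D π := by
  -- One current vertex but two stacks, since the two players may reset at different times.
  let Pos := {x : V × (List (V × V) × Bool) × (List (V × V) × Bool) //
    ResetInv E own C Z τ x.1 x.2.1 ∧ ResetInv E (fun v => ¬ own v) D Z' τ' x.1 x.2.2}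
  have step : ∀ x : Pos, ∃ y : Pos, E x.1.1 y.1.1 ∧ ResetStep C x.1.1 y.1.1 x.1.2.1 y.1.2.1 ∧
      ResetStep D x.1.1 y.1.1 x.1.2.2 y.1.2.2 := by
    rintro ⟨⟨v, s, s'⟩, hs, hs'⟩
    obtain ⟨w, hw, ⟨t, ht, hi⟩, t', ht', hi'⟩ :=
      (hs.force hZ).exists_common (hs'.force hZ')
    exact ⟨⟨⟨w, t, t'⟩, hi, hi'⟩, hw, ht, ht'⟩
  choose f hf using step
  let x₀ : Pos := ⟨⟨a, ([], false), ([], false)⟩,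
    Or.inl ⟨rfl, a, .nil h⟩, Or.inl ⟨rfl, a, .nil h'⟩⟩
  have hx : ∀ n, f^[n + 1] x₀ = f (f^[n] x₀) := fun n => Function.iterate_succ_apply' f n x₀
  refine ⟨fun n => (f^[n] x₀).1.1, fun n => ?_,
    eventuallyCycles_of_resetStep (s := fun n => (f^[n] x₀).1.2.1) rfl fun n => ?_,
    eventuallyCycles_of_resetStep (s := fun n => (f^[n] x₀).1.2.2) rfl fun n => ?_⟩
  · simpa only [hx] using (hf (f^[n] x₀)).1
  · simpa only [hx] using (hf (f^[n] x₀)).2.1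
  · simpa only [hx] using (hf (f^[n] x₀)).2.2

/-- No infinite path of `E` has both a suffix with cycles in `C` only and a suffix with cycles
outside `C` only. -/
def NoAmbiguity (E : V → V → Prop) (C : Set (List (V × V))) : Prop :=
  ∀ π : ℕ → V, (∀ n, E (π n) (π (n + 1))) → EventuallyCycles C π → ¬ EventuallyCycles Cᶜ π

theorem win_iff_win_reset (hC : NoAmbiguity E C) (z : V) :
    Win E own C ∅ True a [] ↔ Win E own C {z} (Win E own C ∅ True z []) a [] := by
  constructor
  -- The opponent wins the stopped game, whose value at `z` favours the opponent only if the
  -- opponent wins from `z`; so the opponent may reset there.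
  · refine fun h => by_contra fun h' => ?_
    obtain ⟨π, hπ, h₁, h₂⟩ := exists_ambiguous_play (by simp) h
      (by
        rintro _ rfl hz
        exact (win_compl_of_not_win hz).mono fun _ _ => trivial)
      (win_compl_of_not_win h')
    exact hC π hπ h₁ h₂
  -- Here the player with cycles `C` is the one who resets at `z`.
  · refine fun h => by_contra fun h' => ?_
    obtain ⟨π, hπ, h₁, h₂⟩ := exists_ambiguous_play
      (by
        rintro _ rfl hz
        exact hz) h (by simp) (win_compl_of_not_win h')
    exact hC π hπ h₁ h₂

end Ambiguity

/-! ### Fixing one edge at a time -/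

section Restriction

variable {V : Type*} {E : V → V → Prop} {own : V → Prop} {C : Set (List (V × V))}

/-- Keep only the edge to `f v` at every vertex `v` of `S`. -/
def restrictEdges (E : V → V → Prop) (S : Set V) (f : V → V) (v w : V) : Prop :=
  E v w ∧ (v ∈ S → w = f v)

theorem isChain_of_trace {P : V → List (V × V) → Prop} {a v : V} {st : List (V × V)}
    (h : Trace P a st v) : st.IsChain (fun e f => e.2 = f.1) ∧
      (∀ hs : st ≠ [], (st.head hs).1 = a ∧ (st.getLast hs).2 = v) ∧ (st = [] → a = v) := by
  induction h with
  | nil => simp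
  | @snoc st v w h _ ih =>
    obtain ⟨hc, he, hn⟩ := ih
    by_cases hs : st = []
    · subst hs
      simp [hn rfl]
    · refine ⟨?_, fun _ => ?_, by simp⟩
      · rw [List.isChain_append]
        refine ⟨hc, by simp, fun x hx y hy => ?_⟩
        rw [List.getLast?_eq_getLast_of_ne_nil hs] at hx
        simp at hx hy
        subst hx hy
        exact (he hs).2
      · simp [List.head_append_of_ne_nil hs, (he hs).1]

theorem popCycle_ne_none_of_trace {P : V → List (V × V) → Prop} {a v : V} {st : List (V × V)}
    (h : Trace P a st v) : (popCycle (st ++ [(v, a)])).2 ≠ none := by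
  intro hn
  refine (popCycle_of_none hn).2 [] _ rfl ?_
  have h' : Trace (fun _ _ => True) a (st ++ [(v, a)]) a := by
    refine .snoc ?_ trivial
    clear hn
    induction h with
    | nil => exact .nil trivial
    | snoc _ _ ih => exact .snoc ih trivial
  obtain ⟨hc, he, -⟩ := isChain_of_trace h'
  exact ⟨by simp, hc, (he _).2.trans (he (by simp)).1.symm⟩

theorem Win.exists_restrict_self {z : V} (hz : own z) (h : Win E own C ∅ True z []) :
    ∃ e, E z e ∧ ∀ f : V → V, f z = e →
      Win (restrictEdges E {z} f) own C ∅ True z [] := by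
  obtain ⟨e, he, hcont⟩ := h.force.1 hz
  -- Under this invariant `z` occurs only as the start. `Trace` records that the path began at `z`,
  -- so that returning there closes a cycle.
  refine ⟨e, he, fun f hf => ⟨fun v st => (v = z ∧ st = []) ∨
    (v ≠ z ∧ Trace (Win E own C ∅ True) z st v), ?_, Or.inl ⟨rfl, rfl⟩⟩⟩
  have key : ∀ v w st, Trace (Win E own C ∅ True) z st v →
      Cont C ∅ True (Win E own C ∅ True) st v w →
      Cont C ∅ True (fun v st => (v = z ∧ st = []) ∨
        (v ≠ z ∧ Trace (Win E own C ∅ True) z st v)) st v w := by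
    intro v w st ht hw
    refine ⟨fun _ => trivial, fun hwZ => ⟨(hw.2 hwZ).1, fun hn => Or.inr ⟨?_, ?_⟩⟩⟩
    · rintro rfl
      exact popCycle_ne_none_of_trace ht hn
    · exact ht.snoc ((hw.2 hwZ).2 hn)
  rintro v st (⟨rfl, rfl⟩ | ⟨hv, ht⟩)
  · exact ⟨fun _ => ⟨e, ⟨he, fun _ => hf.symm⟩, key _ _ _ (.nil h) hcont⟩,
      fun hv => absurd hz hv⟩
  · have hf := ht.holds.force
    refine ⟨fun ho => ?_, fun ho w hw => key _ _ _ ht (hf.2 ho w hw.1)⟩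
    obtain ⟨w, hw, hc⟩ := hf.1 ho
    exact ⟨w, ⟨hw, fun h => absurd h hv⟩, key _ _ _ ht hc⟩

/-- The stopped game never moves out of `z`, so the choice of `f` is irrelevant. The values `τ` and
`τ'` are meant to be the outcomes from `z` before and after the restriction. -/
theorem Win.restrict_of_ne {z a : V} {τ τ' : Prop} (f : V → V) (ha : a ≠ z) (hτ : τ → τ')
    (h : Win E own C {z} τ a []) : Win (restrictEdges E {z} f) own C {z} τ' a [] := by
  refine ⟨fun v st => v ≠ z ∧ Win E own C {z} τ v st, fun v st ⟨hv, h⟩ => ?_, ha, h⟩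
  have hf : Force E own v (Cont C {z} τ' (fun v st => v ≠ z ∧ Win E own C {z} τ v st) st v) :=
    h.force.mono fun w _ hw => hw.mono (fun _ => hτ) fun hw h => ⟨hw, h⟩
  refine ⟨fun ho => ?_, fun ho w hw => hf.2 ho w hw.1⟩
  obtain ⟨w, hw, hc⟩ := hf.1 ho
  exact ⟨w, ⟨hw, fun h => absurd h hv⟩, hc⟩

theorem NoAmbiguity.restrictEdges (h : NoAmbiguity E C) (S : Set V) (f : V → V) :
    NoAmbiguity (restrictEdges E S f) C :=
  fun π hπ => h π fun n => (hπ n).1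

theorem exists_restrict_vertex (hE : ∀ v, ∃ w, E v w) (hC : NoAmbiguity E C) {z : V}
    (hz : own z) : ∃ e, E z e ∧ ∀ f : V → V, f z = e → ∀ a, Win E own C ∅ True a [] →
      Win (restrictEdges E {z} f) own C ∅ True a [] := by
  obtain ⟨e, he, hself⟩ : ∃ e, E z e ∧ ∀ f : V → V, f z = e → Win E own C ∅ True z [] →
      Win (restrictEdges E {z} f) own C ∅ True z [] := by
    by_cases h : Win E own C ∅ True z []
    · obtain ⟨e, he, h'⟩ := h.exists_restrict_self hz
      exact ⟨e, he, fun f hf _ => h' f hf⟩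
    · obtain ⟨e, he⟩ := hE z
      exact ⟨e, he, fun _ _ h' => absurd h' h⟩
  refine ⟨e, he, fun f hf a h => ?_⟩
  by_cases ha : a = z
  · subst ha
    exact hself f hf h
  · rw [win_iff_win_reset (hC.restrictEdges _ _) z]
    exact ((win_iff_win_reset hC z).1 h).restrict_of_ne f ha (hself f hf)

theorem exists_restrict_set (hE : ∀ v, ∃ w, E v w) (hC : NoAmbiguity E C) {S : Set V}
    (hS : S.Finite) (hown : ∀ v ∈ S, own v) : ∃ f : V → V, (∀ v, E v (f v)) ∧
      ∀ a, Win E own C ∅ True a [] → Win (restrictEdges E S f) own C ∅ True a [] := by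
  classical
  induction S, hS using Set.Finite.induction_on with
  | empty =>
    choose f hf using hE
    have : restrictEdges E ∅ f = E := by
      funext v w
      simp [restrictEdges]
    exact ⟨f, hf, fun a h => by rwa [this]⟩
  | @insert z S hzS _ ih =>
    obtain ⟨f, hf, hwin⟩ := ih fun v hv => hown v (Set.mem_insert_of_mem z hv)
    -- Since `f` follows edges everywhere, the restricted graph has no dead ends.
    obtain ⟨e, he, hres⟩ := exists_restrict_vertex (E := restrictEdges E S f)
      (fun v => ⟨f v, hf v, fun _ => rfl⟩) (hC.restrictEdges S f) (hown z (Set.mem_insert z S))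
    refine ⟨Function.update f z e, fun v => ?_, fun a h => ?_⟩
    · by_cases hv : v = z
      · subst hv
        simpa using he.1
      · simpa [hv] using hf v
    · have : restrictEdges E (insert z S) (Function.update f z e) =
          restrictEdges (restrictEdges E S f) {z} (Function.update f z e) := by
        funext v w
        by_cases hv : v = z
        · subst hv
          simp [restrictEdges, hzS]
        · simp [restrictEdges, hv]
      rw [this]
      exact hres _ (by simp) a (hwin a h)

end Restriction

/-! ### From positions to actual plays -/

section FirstCycle

variable {V : Type*}

theorem stack_of_output_none {π : ℕ → V} {n : ℕ} (h : ∀ j < n, output π j = none) :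
    stack π n = (List.range n).map fun j => (π j, π (j + 1)) := by
  induction n with
  | zero => rfl
  | succ n ih =>
    rw [stack, (popCycle_of_none (h n n.lt_succ_self)).1, ih fun j hj => h j (hj.trans n.lt_succ_self),
      List.range_succ, List.map_append, List.map_singleton]

theorem trace_path (π : ℕ → V) (m n : ℕ) : Trace (fun _ _ => True) (π m)
    ((List.range n).map fun j => (π (m + j), π (m + j + 1))) (π (m + n)) := by
  induction n with
  | zero => exact .nil trivial
  | succ n ih =>
    rw [List.range_succ, List.map_append, List.map_singleton]
    exact ih.snoc trivial

theorem exists_isFirstCycle [Finite V] (π : ℕ → V) : ∃ u, IsFirstCycle π u := by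
  classical
  by_cases h : ∃ j, output π j ≠ none
  · obtain ⟨u, hu⟩ := Option.ne_none_iff_exists'.1 (Nat.find_spec h)
    exact ⟨u, Nat.find h, hu, fun i hi => not_not.1 (Nat.find_min h hi)⟩
  · push Not at h
    obtain ⟨m, n, hmn, heq⟩ := Finite.exists_ne_map_eq_of_infinite π
    wlog hlt : m < n generalizing m n
    · exact this n m hmn.symm heq.symm (lt_of_le_of_ne (not_lt.1 hlt) hmn.symm)
    obtain ⟨k, rfl⟩ := Nat.exists_eq_add_of_lt hlt
    -- With no output so far the stack is the whole path, so a repeated vertex makes its top edges a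
    -- cycle.
    have hnone := h (m + k)
    rw [output, stack_of_output_none fun j _ => h j] at hnone
    have ht := trace_path π m (k + 1)
    obtain ⟨hc, he, -⟩ := isChain_of_trace ht
    refine absurd ?_ ((popCycle_of_none hnone).2
      ((List.range m).map fun j => (π j, π (j + 1)))
      ((List.range (k + 1)).map fun j => (π (m + j), π (m + j + 1))) ?_)
    · exact ⟨by simp, hc, (he _).2.trans (heq.symm.trans (he (by simp)).1.symm)⟩
    · simp [List.range_add, List.range_succ, Function.comp_def]

theorem IsFirstCycle.unique {π : ℕ → V} {u u' : List (V × V)} (h : IsFirstCycle π u)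
    (h' : IsFirstCycle π u') : u = u' := by
  obtain ⟨j, hj, hlt⟩ := h
  obtain ⟨j', hj', hlt'⟩ := h'
  rcases lt_trichotomy j j' with hl | rfl | hl
  · simp [hlt' j hl] at hj
  · simpa using hj.symm.trans hj'
  · simp [hlt j' hl] at hj'

theorem firstCycle_mem_of_win {E : V → V → Prop} {own : V → Prop} {C : Set (List (V × V))}
    {f : V → V} {π : ℕ → V} {u : List (V × V)}
    (h : Win (restrictEdges E {v | own v} f) own C ∅ True (π 0) [])
    (hπ : ∀ n, E (π n) (π (n + 1))) (hf : ∀ n, own (π n) → π (n + 1) = f (π n))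
    (hu : IsFirstCycle π u) : u ∈ C := by
  obtain ⟨j, hj, hlt⟩ := hu
  have hcont : ∀ n, Win (restrictEdges E {v | own v} f) own C ∅ True (π n) (stack π n) →
      Cont C ∅ True (Win (restrictEdges E {v | own v} f) own C ∅ True) (stack π n) (π n)
        (π (n + 1)) := by
    intro n hn
    by_cases ho : own (π n)
    · obtain ⟨w, hw, hc⟩ := hn.force.1 ho
      rwa [hf n ho, ← hw.2 ho]
    · exact hn.force.2 ho _ ⟨hπ n, fun h => absurd h ho⟩
  have hwin : ∀ n ≤ j, Win (restrictEdges E {v | own v} f) own C ∅ True (π n) (stack π n) := by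
    intro n hn
    induction n with
    | zero => exact h
    | succ n ih =>
      have hnone : output π n = none := hlt n hn
      rw [stack, (popCycle_of_none hnone).1]
      exact ((hcont n (ih (Nat.le_of_succ_le hn))).2 (Set.notMem_empty _)).2 hnone
  exact ((hcont j (hwin j le_rfl)).2 (Set.notMem_empty _)).1 u hj

end FirstCycle

/-! ### Strategies, determinacy and the conclusion -/

section Games

variable {V U : Type*}

/-- The cycles whose closing makes Player `i` win the first cycle game of `Y`. -/
def winningCycles (A : Arena V U) (Y : Set (List U)) (i : Fin 2) : Set (List (V × V)) :=
  {c | if i = 0 then c.map A.label ∈ Y else c.map A.label ∉ Y}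

theorem winningCycles_compl (A : Arena V U) (Y : Set (List U)) (i : Fin 2) :
    (winningCycles A Y i)ᶜ = winningCycles A Y (1 - i) := by
  fin_cases i <;> ext c <;> simp [winningCycles]

theorem wonBy_of_firstCycle {A : Arena V U} {Y : Set (List U)} {i : Fin 2} {π : ℕ → V}
    {u : List (V × V)} (hπ : π ∈ plays A) (hu : IsFirstCycle π u)
    (h : u ∈ winningCycles A Y i) : WonBy (firstCycleObjective A Y) i π := by
  unfold WonBy
  unfold winningCycles at h
  split_ifs with hi
  · exact ⟨hπ, u, hu, by simpa [hi] using h⟩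
  · rintro ⟨-, u', hu', hY⟩
    rw [← hu.unique hu'] at hY
    simp [hi, hY] at h

theorem Unambiguous.noAmbiguity {A : Arena V U} {Y : Set (List U)} (h : Unambiguous A Y)
    (i : Fin 2) : NoAmbiguity A.edge (winningCycles A Y i) := by
  intro π hπ h₁ h₂
  rw [winningCycles_compl] at h₂
  have key : ∀ k : Fin 2, EventuallyCycles (winningCycles A Y k) π →
      π ∈ suffixAllCyclesObjective A (if k = 0 then Y else Yᶜ) := by
    rintro k ⟨m, hm⟩
    refine ⟨hπ, m, fun u hu => ?_⟩
    have := hm u hu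
    unfold winningCycles at this
    split_ifs with hk <;> simpa [hk] using this
  have h₁ := key _ h₁
  have h₂ := key _ h₂
  have hmem : π ∈ suffixAllCyclesObjective A Y ∩ suffixAllCyclesObjective A Yᶜ := by
    fin_cases i <;> simp at h₁ h₂
    · exact ⟨h₁, h₂⟩
    · exact ⟨h₂, h₁⟩
  rw [h] at hmem
  exact hmem

/-- Player `i` wins the first cycle game of `Y` from `a`, in terms of positions. -/
def WinsFrom (A : Arena V U) (Y : Set (List U)) (i : Fin 2) (a : V) : Prop :=
  Win A.edge (fun v => A.owner v = i) (winningCycles A Y i) ∅ True a []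

theorem winsFrom_or (A : Arena V U) (Y : Set (List U)) (i : Fin 2) (a : V) :
    WinsFrom A Y i a ∨ WinsFrom A Y (1 - i) a := by
  refine or_iff_not_imp_left.2 fun h => ?_
  have h' := (win_compl_of_not_win h).mono (τ' := True) fun _ _ => trivial
  rw [winningCycles_compl] at h'
  have hown : (fun v => ¬ A.owner v = i) = fun v => A.owner v = 1 - i := by
    funext v
    generalize A.owner v = k
    fin_cases i <;> fin_cases k <;> simp
  rwa [hown] at h'

theorem exists_memoryless_winning [Finite V] {A : Arena V U} {Y : Set (List U)}
    (hA : Unambiguous A Y) (i : Fin 2) : ∃ S : Strategy A i, S.Memoryless ∧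
      ∀ a, WinsFrom A Y i a → S.WinningFrom (firstCycleObjective A Y) a := by
  obtain ⟨f, hf, hwin⟩ := exists_restrict_set (own := fun v => A.owner v = i) A.noDeadEnd
    (hA.noAmbiguity i) (Set.toFinite {v | A.owner v = i}) fun _ => id
  refine ⟨⟨fun _ v => f v, fun _ v _ => hf v⟩, fun _ _ _ _ => rfl, fun a ha π hπ h0 hS => ?_⟩
  obtain ⟨u, hu⟩ := exists_isFirstCycle π
  subst h0
  exact wonBy_of_firstCycle hπ hu (firstCycle_mem_of_win (hwin _ ha) hπ hS hu)

/-- The history and the current vertex after `n` moves by `move` from `a`. -/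
def playOut (move : List V → V → V) (a : V) : ℕ → List V × V
  | 0 => ([], a)
  | n + 1 => ((playOut move a n).1 ++ [(playOut move a n).2],
      move (playOut move a n).1 (playOut move a n).2)

theorem playOut_history (move : List V → V → V) (a : V) (n : ℕ) :
    (playOut move a n).1 = (List.range n).map fun j => (playOut move a j).2 := by
  induction n with
  | zero => rfl
  | succ n ih => rw [playOut, ih, List.range_succ, List.map_append, List.map_singleton]

theorem exists_consistent_play {A : Arena V U} (S : Strategy A 0) (T : Strategy A 1) (a : V) :
    ∃ π ∈ plays A, π 0 = a ∧ S.Consistent π ∧ T.Consistent π := by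
  let move : List V → V → V := fun u v => if A.owner v = 0 then S.move u v else T.move u v
  have hstep : ∀ n, (playOut move a (n + 1)).2 =
      move ((List.range n).map fun j => (playOut move a j).2) (playOut move a n).2 := by
    intro n
    rw [← playOut_history]
    rfl
  refine ⟨fun n => (playOut move a n).2, fun n => ?_, rfl, fun n hn => ?_, fun n hn => ?_⟩
  · simp only [hstep, move]
    split_ifs with h
    · exact S.legal _ _ h
    · exact T.legal _ _ (by omega)
  · simp only [hstep]
    exact if_pos hn
  · simp only [hstep]
    exact if_neg (by rw [hn]; exact one_ne_zero)

theorem disjoint_winningRegion (A : Arena V U) (O : Set (ℕ → V)) :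
    Disjoint (winningRegion A O 0) (winningRegion A O 1) := by
  rw [Set.disjoint_left]
  rintro a ⟨S, hS⟩ ⟨T, hT⟩
  obtain ⟨π, hπ, h0, hcS, hcT⟩ := exists_consistent_play S T a
  have h₁ := hS π hπ h0 hcS
  have h₂ := hT π hπ h0 hcT
  simp only [WonBy, one_ne_zero, if_true, if_false] at h₁ h₂
  exact h₂ h₁

theorem Unambiguous.uniformMemorylessDetermined [Finite V] {A : Arena V U} {Y : Set (List U)}
    (hA : Unambiguous A Y) : UniformMemorylessDetermined A (firstCycleObjective A Y) := by
  have hreg : ∀ i a, WinsFrom A Y i a → a ∈ winningRegion A (firstCycleObjective A Y) i := by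
    intro i a ha
    obtain ⟨S, -, hS⟩ := exists_memoryless_winning hA i
    exact ⟨S, hS a ha⟩
  have hdisj := Set.disjoint_left.1 (disjoint_winningRegion A (firstCycleObjective A Y))
  refine ⟨⟨disjoint_winningRegion A _, Set.eq_univ_of_forall fun a =>
    (winsFrom_or A Y 0 a).imp (hreg 0 a) (hreg 1 a)⟩, fun i => ?_⟩
  obtain ⟨S, hS, hwin⟩ := exists_memoryless_winning hA i
  -- No strategy is translated back into positions: if `WinsFrom` failed for `i`, the opponent would
  -- have a winning strategy too, against disjointness of the regions.
  refine ⟨S, hS, fun a ha => hwin a ((winsFrom_or A Y i a).resolve_right fun h => ?_)⟩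
  have h := hreg _ _ h
  fin_cases i
  · exact hdisj ha h
  · exact hdisj h ha

theorem UniformMemorylessDetermined.pointwise {A : Arena V U} {O : Set (ℕ → V)}
    (h : UniformMemorylessDetermined A O) : PointwiseMemorylessDetermined A O := by
  refine ⟨h.1, fun i => Set.Subset.antisymm (fun a ⟨S, _, hS⟩ => ⟨S, hS⟩) fun a ha => ?_⟩
  obtain ⟨S, hS, hwin⟩ := h.2 i
  exact ⟨S, hS, hwin a ha⟩

end Games

end CycleGame

theorem mainTheorem2 {V U : Type*} [Finite V] [Nonempty V]
    (A : CycleGame.Arena V U) (Y : Set (List U)) (hA : CycleGame.Unambiguous A Y) :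
    CycleGame.PointwiseMemorylessDetermined A (CycleGame.firstCycleObjective A Y) ∧
    (CycleGame.ClosedUnderCyclicPermutations Y →
      CycleGame.UniformMemorylessDetermined A (CycleGame.firstCycleObjective A Y)) :=
  ⟨hA.uniformMemorylessDetermined.pointwise, fun _ => hA.uniformMemorylessDetermined⟩
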